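/- For a finite partially ordered set $P$ let $\mathcal S(P)$ be its nerve, i.e. the simplicial set whose $n$-simplices are the order preserving maps $\{0<1<\cdots<n\}\to P$, with simplicial operators given by precomposition. Let $|C|$ denote the geometric realization of a simplicial set $C$, i.e. the colimit in topological spaces of the topological standard simplices $|\Delta_n|=\{(x_0,\dots,x_n)\in\mathbb R^{n+1} : x_i\ge 0,\ \sum_i x_i=1\}$ over all maps $\Delta_n\to C$, where $\Delta_n$ is the simplicial set represented by $[n]=\{0<\cdots<n\}$. Products of simplicial sets are taken levelwise, and products of spaces carry the product topology. (1) For all finite partially ordered sets $P$ and $Q$, the canonical map $$|\mathcal S(P)\times\mathcal S(Q)|\longrightarrow|\mathcal S(P)|\times|\mathcal S(Q)|,$$ whose components are the realizations of the two projections, is a homeomorphism. (2) In particular, for all integers $n,m\ge 0$, the canonical map $|\Delta_n\times\Delta_m|\to|\Delta_n|\times|\Delta_m|$ induced by the two projections is a homeomorphism, both when $|\Delta_n|$ and $|\Delta_m|$ are read as geometric realizations of simplicial sets and when these are identified with the topological standard simplices in $\mathbb R^{n+1}$ and $\mathbb R^{m+1}$ in the canonical way. -/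

import Mathlib

open CategoryTheory MonoidalCategory CartesianMonoidalCategory Simplicial

universe u

/-- The simplicial set `S(P)` of a partially ordered set `P`: the nerve of `P`, regarded as a
category with a unique morphism `x ⟶ y` if `x ≤ y`. Its `n`-simplices are the order preserving
maps `{0 < 1 < ⋯ < n} → P`, see `posetSSetEquiv` and `posetSSetEquiv_map`. -/
abbrev posetSSet (P : Type u) [PartialOrder P] : SSet.{u} :=
  nerve P

/-- The simplices of `S(P)` of dimension `n` are the order preserving maps from `[n]` to `P`. -/
def posetSSetEquiv (P : Type u) [PartialOrder P] (n : SimplexCategoryᵒᵖ) :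
    (posetSSet P).obj n ≃ (Fin (n.unop.len + 1) →o P) where
  toFun s := ⟨s.obj, s.monotone⟩
  invFun f := f.monotone.functor
  left_inv _ := rfl
  right_inv _ := rfl

/-- The simplicial operators of `S(P)` are given by precomposition. -/
theorem posetSSetEquiv_map (P : Type u) [PartialOrder P] {n m : SimplexCategoryᵒᵖ} (θ : n ⟶ m)
    (s : (posetSSet P).obj n) :
    posetSSetEquiv P m ((posetSSet P).map θ s) =
      (posetSSetEquiv P n s).comp θ.unop.toOrderHom :=
  rfl

/-- The canonical map `|C × D| → |C| × |D|` whose components are the geometric realizations of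
the two projections `C × D → C` and `C × D → D`. The product `C ⊗ D` of simplicial sets is the
levelwise cartesian product, and `|C| × |D|` has the product topology. -/
noncomputable def realizationProdMap (C D : SSet.{u}) (x : SSet.toTop.obj (C ⊗ D)) :
    SSet.toTop.obj C × SSet.toTop.obj D :=
  (SSet.toTop.map (fst C D) x, SSet.toTop.map (snd C D) x)

/-! For a finite poset `R`, affine extension sends `|S(R)|` injectively into the simplex of
probability distributions on `R`, and every image point has a chain as support. Since `S(P × Q) ≅
S(P) × S(Q)`, the canonical map turns a chain-supported distribution on `P × Q` into its two
marginals. It is injective because, on a chain, the joint cumulative sum at `(p, q)` is the minimum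
of the marginal ones (`sum_le_eq_min`), and cumulative sums determine a distribution
(`eq_of_sum_le_eq`). It is surjective because two distributions on finite linear orders have a
monotone coupling (`exists_isChain_coupling`). A continuous bijection from a compact space to a
Hausdorff one is a homeomorphism; `Δ[n]` is the nerve of a finite linear order. -/

namespace GeometricRealization

open Opposite SimplexCategory
open SSet (toTop yonedaEquiv yonedaEquiv_symm_comp)

/-! ### Points of a realization and its universal property -/

/-- The point of the geometric realization of `C` given by a simplex `s` of `C` and a point `t` of
the topological standard simplex. -/
noncomputable def realizationMk {C : SSet.{u}} {n : SimplexCategory} (s : C.obj (op n))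
    (t : stdSimplex ℝ (Fin (n.len + 1))) : |C| :=
  toTop.map (yonedaEquiv.symm s) (n.toTopHomeo.symm t)

lemma continuous_realizationMk {C : SSet.{u}} {n : SimplexCategory} (s : C.obj (op n)) :
    Continuous (realizationMk s) :=
  (toTop.map (yonedaEquiv.symm s)).hom.continuous.comp n.toTopHomeo.symm.continuous

lemma toTop_map_realizationMk {C D : SSet.{u}} (f : C ⟶ D) {n : SimplexCategory}
    (s : C.obj (op n)) (t : stdSimplex ℝ (Fin (n.len + 1))) :
    toTop.map f (realizationMk s t) = realizationMk (f.app _ s) t := by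
  simp only [realizationMk, ← yonedaEquiv_symm_comp, Functor.map_comp]
  rfl

lemma realizationMk_map {C : SSet.{u}} {n m : SimplexCategory} (θ : n ⟶ m)
    (s : C.obj (op m)) (t : stdSimplex ℝ (Fin (n.len + 1))) :
    realizationMk (C.map θ.op s) t = realizationMk s (stdSimplex.map θ t) := by
  have h : yonedaEquiv.symm (C.map θ.op s) = SSet.stdSimplex.map θ ≫ yonedaEquiv.symm s :=
    uliftYonedaEquiv_symm_map θ.op s
  rw [realizationMk, h, Functor.map_comp, realizationMk, toTopHomeo_symm_naturality_apply]
  rfl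

lemma sSetTopAdj_unit_apply {C : SSet.{u}} {n : SimplexCategory} (s : C.obj (op n))
    (t : stdSimplex ℝ (Fin (n.len + 1))) :
    TopCat.toSSetObjEquiv _ _ ((sSetTopAdj.unit.app C).app (op n) s) t = realizationMk s t := by
  have := sSetTopAdj_unit_app_app_down C (op n) s
  exact ConcreteCategory.congr_hom this (ULift.up t)

lemma toTop_hom_ext {C : SSet.{u}} {X : TopCat.{u}} {f g : |C| ⟶ X}
    (h : ∀ (n : SimplexCategory) (s : C.obj (op n)) (t : stdSimplex ℝ (Fin (n.len + 1))),
      f (realizationMk s t) = g (realizationMk s t)) : f = g := by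
  apply (sSetTopAdj.homEquiv C X).injective
  ext ⟨n⟩ s
  apply (TopCat.toSSetObjEquiv X (op n)).injective
  ext t
  have := h n s t
  rw [← sSetTopAdj_unit_apply] at this
  simp only [Adjunction.homEquiv_unit]
  exact this

/-- Every point of the geometric realization lies in the image of a standard simplex. -/
lemma exists_realizationMk_eq {C : SSet.{u}} (x : |C|) :
    ∃ (n : SimplexCategory) (s : C.obj (op n)) (t : stdSimplex ℝ (Fin (n.len + 1))),
      realizationMk s t = x := by
  -- Every function into an indiscrete space is continuous, so uniqueness of maps out of `|C|`
  -- forces joint surjectivity of the simplices.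
  let Y : TopCat.{u} := @TopCat.of (ULift Prop) ⊤
  let f : |C| ⟶ Y := @TopCat.ofHom _ _ _ ⊤ (@ContinuousMap.mk _ _ _ ⊤
    (fun x ↦ ULift.up (∃ (n : SimplexCategory) (s : C.obj (op n))
      (t : stdSimplex ℝ (Fin (n.len + 1))), realizationMk s t = x)) continuous_top)
  let g : |C| ⟶ Y := @TopCat.ofHom _ _ _ ⊤ (@ContinuousMap.mk _ _ _ ⊤
    (fun _ ↦ ULift.up True) continuous_top)
  have hfg : f = g := toTop_hom_ext fun n s t ↦ congrArg ULift.up (eq_true ⟨n, s, t, rfl⟩)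
  exact of_eq_true (congrArg ULift.down (ConcreteCategory.congr_hom hfg x))

/-- The continuous map out of the geometric realization of `C` given by a compatible family of
continuous maps on the topological standard simplices. -/
noncomputable def realizationDesc {C : SSet.{u}} {X : TopCat.{u}}
    (φ : ∀ n : SimplexCategory, C.obj (op n) → C(stdSimplex ℝ (Fin (n.len + 1)), X))
    (hφ : ∀ (n m : SimplexCategory) (θ : n ⟶ m) (s : C.obj (op m)) t,
      φ n (C.map θ.op s) t = φ m s (stdSimplex.map θ t)) : |C| ⟶ X :=
  (sSetTopAdj.homEquiv C X).symm
    { app n := TypeCat.ofHom fun s ↦ (TopCat.toSSetObjEquiv X n).symm (φ n.unop s)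
      naturality n m θ := by
        ext s
        apply (TopCat.toSSetObjEquiv X m).injective
        ext t
        exact hφ _ _ θ.unop s t }

lemma realizationDesc_realizationMk {C : SSet.{u}} {X : TopCat.{u}}
    (φ : ∀ n : SimplexCategory, C.obj (op n) → C(stdSimplex ℝ (Fin (n.len + 1)), X))
    (hφ : ∀ (n m : SimplexCategory) (θ : n ⟶ m) (s : C.obj (op m)) t,
      φ n (C.map θ.op s) t = φ m s (stdSimplex.map θ t))
    {n : SimplexCategory} (s : C.obj (op n)) (t : stdSimplex ℝ (Fin (n.len + 1))) :
    realizationDesc φ hφ (realizationMk s t) = φ n s t := by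
  set f := realizationDesc φ hφ with hf
  have h := (Equiv.symm_apply_eq _).1 hf.symm
  rw [Adjunction.homEquiv_unit] at h
  have h' := congrArg (fun ψ ↦ TopCat.toSSetObjEquiv X (op n) (ψ.app (op n) s) t) h
  rw [← sSetTopAdj_unit_apply]
  exact h'.symm

end GeometricRealization

/-! ### Distributions supported on chains -/

namespace stdSimplex

variable {X Y P Q : Type*} [Fintype X] [Fintype Y] [Fintype P] [Fintype Q]

lemma map_apply [DecidableEq Y] (f : X → Y) (s : stdSimplex ℝ X) (y : Y) :
    map f s y = ∑ x with f x = y, s x := by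
  rw [map_coe, FunOnFinite.linearMap_apply_apply]

lemma le_map_apply (f : X → Y) (s : stdSimplex ℝ X) (x : X) : s x ≤ map f s (f x) := by
  classical
  rw [map_apply]
  exact Finset.single_le_sum (fun i _ ↦ s.2.1 i) (by simp)

lemma exists_of_map_apply_ne_zero {f : X → Y} {s : stdSimplex ℝ X} {y : Y}
    (h : map f s y ≠ 0) : ∃ x, f x = y ∧ s x ≠ 0 := by
  classical
  rw [map_apply] at h
  obtain ⟨x, hx, h⟩ := Finset.exists_ne_zero_of_sum_ne_zero h
  exact ⟨x, by simpa using hx, h⟩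

lemma map_apply_of_injective {f : X → Y} (hf : Function.Injective f) (s : stdSimplex ℝ X) (x : X) :
    map f s (f x) = s x := by
  classical
  simp [map_apply, hf.eq_iff, Finset.sum_filter]

lemma map_injective {f : X → Y} (hf : Function.Injective f) :
    Function.Injective (map (S := ℝ) f) := by
  intro s t h
  ext x
  rw [← map_apply_of_injective hf, h, map_apply_of_injective hf]

lemma map_fst_apply (x : stdSimplex ℝ (P × Q)) (p : P) : map Prod.fst x p = ∑ q, x (p, q) := by
  classical
  simp [map_apply, Finset.sum_filter, Fintype.sum_prod_type_right]

lemma map_snd_apply (x : stdSimplex ℝ (P × Q)) (q : Q) : map Prod.snd x q = ∑ p, x (p, q) := by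
  classical
  simp [map_apply, Finset.sum_filter, Fintype.sum_prod_type]

lemma exists_ne_zero (s : stdSimplex ℝ X) : ∃ x, s x ≠ 0 := by
  obtain ⟨x, -, h⟩ := Finset.exists_ne_zero_of_sum_ne_zero
    (s := Finset.univ) (f := s) (by rw [sum_eq_one]; exact one_ne_zero)
  exact ⟨x, h⟩

lemma isChain_support_map [LinearOrder X] [PartialOrder Y] (f : X →o Y) (s : stdSimplex ℝ X) :
    IsChain (· ≤ ·) {y | map f s y ≠ 0} := by
  intro y hy y' hy' _
  obtain ⟨x, rfl, -⟩ := exists_of_map_apply_ne_zero hy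
  obtain ⟨x', rfl, -⟩ := exists_of_map_apply_ne_zero hy'
  exact (le_total x x').imp (fun h ↦ f.monotone h) (fun h ↦ f.monotone h)

/-- A point of the standard simplex on a poset whose support is a chain is carried by an
enumeration of this chain. -/
lemma exists_map_orderEmbedding_eq [PartialOrder P] (w : stdSimplex ℝ P)
    (hw : IsChain (· ≤ ·) {p | w p ≠ 0}) :
    ∃ (k : ℕ) (c : Fin (k + 1) ↪o P) (t : stdSimplex ℝ (Fin (k + 1))),
      map c t = w ∧ Set.range c = {p | w p ≠ 0} := by
  classical
  let S : Set P := {p | w p ≠ 0}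
  let : LinearOrder S :=
    { (inferInstance : PartialOrder S) with
      le_total a b := hw.total a.2 b.2
      toDecidableLE := Classical.decRel _ }
  obtain ⟨p, hp⟩ := exists_ne_zero w
  have : Nonempty S := ⟨⟨p, hp⟩⟩
  obtain ⟨k, hk⟩ := Nat.exists_eq_succ_of_ne_zero (Fintype.card_ne_zero (α := S))
  let e : Fin (k + 1) ≃o S := Fintype.orderIsoFinOfCardEq S hk
  let c : Fin (k + 1) ↪o P := e.toOrderEmbedding.trans (OrderEmbedding.subtype _)
  have hc : Set.range c = S := by
    ext p
    refine ⟨?_, fun h ↦ ⟨e.symm ⟨p, h⟩, by simp [c]⟩⟩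
    rintro ⟨i, rfl⟩
    exact (e i).2
  have hsum : ∑ i, w (c i) = 1 := by
    rw [← sum_eq_one w]
    refine (Finset.sum_map Finset.univ c.toEmbedding w).symm.trans ?_
    refine Finset.sum_subset (Finset.subset_univ _) fun p _ hp ↦ ?_
    by_contra h
    obtain ⟨i, rfl⟩ : p ∈ Set.range c := hc ▸ h
    exact hp (by simp)
  refine ⟨k, c, ⟨fun i ↦ w (c i), fun i ↦ w.2.1 _, hsum⟩, ?_, hc⟩
  ext p
  by_cases hp : p ∈ Set.range c
  · obtain ⟨i, rfl⟩ := hp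
    exact map_apply_of_injective c.injective _ i
  · have : w p = 0 := by by_contra h; exact hp (hc ▸ h)
    rw [this]
    by_contra h
    obtain ⟨i, hi, -⟩ := exists_of_map_apply_ne_zero h
    exact hp ⟨i, hi⟩

/-- The conditions `r.1 ≤ p` and `r.2 ≤ q` cut out initial segments of the chain. One of these
contains the other, so their intersection is the lighter one. -/
lemma sum_le_eq_min [PartialOrder P] [PartialOrder Q] [DecidableLE P] [DecidableLE Q]
    (x : stdSimplex ℝ (P × Q)) (hx : IsChain (· ≤ ·) {r | x r ≠ 0}) (p : P) (q : Q) :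
    ∑ r with r ≤ (p, q), x r =
      min (∑ a with a ≤ p, map Prod.fst x a) (∑ b with b ≤ q, map Prod.snd x b) := by
  have hF : ∑ a with a ≤ p, map Prod.fst x a = ∑ r with r.1 ≤ p, x r := by
    simp_rw [map_fst_apply, Finset.sum_filter, Fintype.sum_prod_type]
    exact Finset.sum_congr rfl fun a _ ↦ by split_ifs <;> simp
  have hG : ∑ b with b ≤ q, map Prod.snd x b = ∑ r with r.2 ≤ q, x r := by
    simp_rw [map_snd_apply, Finset.sum_filter, Fintype.sum_prod_type_right]
    exact Finset.sum_congr rfl fun a _ ↦ by split_ifs <;> simp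
  have hle1 : ∑ r with r ≤ (p, q), x r ≤ ∑ r with r.1 ≤ p, x r :=
    Finset.sum_le_sum_of_subset_of_nonneg
      (Finset.monotone_filter_right _ fun r _ h ↦ h.1) fun r _ _ ↦ x.2.1 r
  have hle2 : ∑ r with r ≤ (p, q), x r ≤ ∑ r with r.2 ≤ q, x r :=
    Finset.sum_le_sum_of_subset_of_nonneg
      (Finset.monotone_filter_right _ fun r _ h ↦ h.2) fun r _ _ ↦ x.2.1 r
  rw [hF, hG]
  by_cases h : ∃ r, x r ≠ 0 ∧ r.1 ≤ p ∧ ¬ r.2 ≤ q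
  · obtain ⟨r, hr, hrp, hrq⟩ := h
    have : ∑ r with r ≤ (p, q), x r = ∑ r with r.2 ≤ q, x r := by
      refine Finset.sum_subset (Finset.monotone_filter_right _ fun r _ h ↦ h.2) fun s hs hs' ↦ ?_
      simp only [Finset.mem_filter_univ] at hs hs'
      by_contra hxs
      rcases hx.total hr hxs with h | h
      · exact hrq (h.2.trans hs)
      · exact hs' ⟨h.1.trans hrp, hs⟩
    rw [← this, min_eq_right]
    exact hle1
  · push Not at h
    have : ∑ r with r ≤ (p, q), x r = ∑ r with r.1 ≤ p, x r := by
      refine Finset.sum_subset (Finset.monotone_filter_right _ fun r _ h ↦ h.1) fun s hs hs' ↦ ?_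
      simp only [Finset.mem_filter_univ] at hs hs'
      by_contra hxs
      exact hs' ⟨hs, h s hxs hs⟩
    rw [← this, min_eq_left]
    exact hle2

/-- The passage to cumulative sums is unitriangular for the order. -/
lemma eq_of_sum_le_eq {R : Type*} [Fintype R] [PartialOrder R] [DecidableLE R] {f g : R → ℝ}
    (h : ∀ r, ∑ s with s ≤ r, f s = ∑ s with s ≤ r, g s) : f = g := by
  classical
  funext r
  induction r using WellFoundedLT.induction with
  | ind r ih =>
    have key : ∀ f : R → ℝ, ∑ s with s ≤ r, f s = f r + ∑ s with s < r, f s := fun f ↦ by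
      rw [← Finset.sum_insert (by simp)]
      congr 1
      ext s
      simp [le_iff_eq_or_lt]
    have := h r
    rw [key, key, Finset.sum_congr rfl fun s hs ↦ ih s (by simpa using hs)] at this
    exact add_right_cancel this

/-- A coupling of two distributions on posets is determined by its marginals if its support is a
chain. -/
lemma eq_of_map_fst_eq_of_map_snd_eq [PartialOrder P] [PartialOrder Q]
    {x y : stdSimplex ℝ (P × Q)} (hx : IsChain (· ≤ ·) {r | x r ≠ 0})
    (hy : IsChain (· ≤ ·) {r | y r ≠ 0}) (h₁ : map Prod.fst x = map Prod.fst y)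
    (h₂ : map Prod.snd x = map Prod.snd y) : x = y := by
  classical
  refine stdSimplex.ext (eq_of_sum_le_eq fun ⟨p, q⟩ ↦ ?_)
  rw [sum_le_eq_min x hx, sum_le_eq_min y hy, h₁, h₂]

/-! ### Monotone couplings -/

/-- The lengths of the intersections of an interval with the pieces of a subdivision of a larger
interval add up to the length of the interval. -/
lemma sum_length_inter {B : ℕ → ℝ} (hB : Monotone B) {a a' : ℝ} (haa' : a ≤ a') {N : ℕ}
    (h₀ : B 0 ≤ a) (h₁ : a' ≤ B N) :
    ∑ j ∈ Finset.range N, max 0 (min a' (B (j + 1)) - max a (B j)) = a' - a := by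
  -- Each length is the increment of `B` clamped to `[a, a']`, so the sum telescopes.
  have : ∀ j, max 0 (min a' (B (j + 1)) - max a (B j)) =
      max a (min (B (j + 1)) a') - max a (min (B j) a') := fun j ↦ by
    have := hB j.le_succ
    grind
  simp_rw [this]
  rw [Finset.sum_range_sub (fun j ↦ max a (min (B j) a'))]
  grind

/-- The cumulative distribution function of a distribution on `Fin n`. -/
def cumulative {n : ℕ} (u : stdSimplex ℝ (Fin n)) (i : ℕ) : ℝ :=
  ∑ a with a.val < i, u a

lemma cumulative_monotone {n : ℕ} (u : stdSimplex ℝ (Fin n)) : Monotone (cumulative u) :=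
  fun _ _ h ↦ Finset.sum_le_sum_of_subset_of_nonneg
    (Finset.monotone_filter_right _ fun _ _ h' ↦ h'.trans_le h) fun a _ _ ↦ u.2.1 a

lemma cumulative_zero {n : ℕ} (u : stdSimplex ℝ (Fin n)) : cumulative u 0 = 0 := by
  simp [cumulative]

lemma cumulative_self {n : ℕ} (u : stdSimplex ℝ (Fin n)) : cumulative u n = 1 := by
  simp [cumulative]

lemma cumulative_succ {n : ℕ} (u : stdSimplex ℝ (Fin n)) (i : Fin n) :
    cumulative u (i + 1) - cumulative u i = u i := by
  have : (Finset.univ.filter fun a : Fin n ↦ a.val < i + 1) =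
      insert i (Finset.univ.filter fun a : Fin n ↦ a.val < i) := by
    ext a
    simp only [Finset.mem_filter_univ, Finset.mem_insert]
    omega
  rw [cumulative, cumulative, this, Finset.sum_insert (by simp)]
  ring

/-- Two distributions on linear orders admit a coupling whose support is a chain. -/
lemma exists_isChain_coupling {n m : ℕ} (u : stdSimplex ℝ (Fin n)) (v : stdSimplex ℝ (Fin m)) :
    ∃ x : stdSimplex ℝ (Fin n × Fin m), IsChain (· ≤ ·) {r | x r ≠ 0} ∧
      map Prod.fst x = u ∧ map Prod.snd x = v := by
  let A := cumulative u
  let B := cumulative v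
  have hA : Monotone A := cumulative_monotone u
  have hB : Monotone B := cumulative_monotone v
  have hA₀ (i) : 0 ≤ A i := by simpa [A, cumulative_zero] using hA i.zero_le
  have hB₀ (i) : 0 ≤ B i := by simpa [B, cumulative_zero] using hB i.zero_le
  have hA₁ (i : Fin n) : A (i + 1) ≤ 1 := (hA i.isLt).trans_eq (cumulative_self u)
  have hB₁ (i : Fin m) : B (i + 1) ≤ 1 := (hB i.isLt).trans_eq (cumulative_self v)
  -- The distributions subdivide `[0, 1]` in two ways; the weight of `(i, j)` is the length of the
  -- overlap of the `i`-th and `j`-th pieces.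
  let f : Fin n × Fin m → ℝ := fun r ↦ max 0 (min (A (r.1 + 1)) (B (r.2 + 1)) - max (A r.1) (B r.2))
  have hf₁ (i : Fin n) : ∑ j, f (i, j) = u i := by
    rw [← cumulative_succ u i]
    refine (Fin.sum_univ_eq_sum_range (fun j ↦
      max 0 (min (A (i + 1)) (B (j + 1)) - max (A i) (B j))) m).trans ?_
    exact sum_length_inter hB (hA (Nat.le_succ _)) ((cumulative_zero v).trans_le (hA₀ _))
      ((hA₁ i).trans_eq (cumulative_self v).symm)
  have hf₂ (j : Fin m) : ∑ i, f (i, j) = v j := by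
    rw [← cumulative_succ v j]
    refine Eq.trans ?_ (sum_length_inter hA (hB (Nat.le_succ _))
      ((cumulative_zero u).trans_le (hB₀ _)) ((hB₁ j).trans_eq (cumulative_self u).symm))
    rw [← Fin.sum_univ_eq_sum_range (fun i ↦
      max 0 (min (B (j + 1)) (A (i + 1)) - max (B j) (A i))) n]
    exact Finset.sum_congr rfl fun i _ ↦ by simp only [f, min_comm, max_comm (B j)]
  refine ⟨⟨f, fun r ↦ le_max_left _ _, ?_⟩, ?_, ?_, ?_⟩
  · rw [Fintype.sum_prod_type]
    simp_rw [hf₁, sum_eq_one]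
  -- Otherwise `B r.2 < A (r.1 + 1) ≤ A s.1 < B (s.2 + 1) ≤ B r.2`.
  · have key : ∀ r s : Fin n × Fin m, f r ≠ 0 → f s ≠ 0 → r.1 < s.1 → r.2 ≤ s.2 := by
      intro r s hr hs h
      by_contra! h'
      have h₁ : A (r.1 + 1) ≤ A s.1 := hA h
      have h₂ : B (s.2 + 1) ≤ B r.2 := hB h'
      grind
    intro r hr s hs _
    rcases lt_trichotomy r.1 s.1 with h | h | h
    · exact .inl ⟨h.le, key r s hr hs h⟩
    · exact (le_total r.2 s.2).imp (fun h' ↦ ⟨h.le, h'⟩) (fun h' ↦ ⟨h.ge, h'⟩)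
    · exact .inr ⟨h.le, key s r hs hr h⟩
  · ext i
    rw [map_fst_apply]
    exact hf₁ i
  · ext j
    rw [map_snd_apply]
    exact hf₂ j

end stdSimplex

/-! ### Realizations of nerves of finite posets -/

namespace GeometricRealization

open Opposite SimplexCategory
open SSet (toTop yonedaEquiv yonedaEquiv_symm_comp)

section Nerve

variable (R : Type u) [PartialOrder R] [Fintype R]

/-- The continuous map `|S(R)| → stdSimplex ℝ R` which is affine on simplices and sends each vertex
to the corresponding vertex. -/
noncomputable def nerveToStdSimplex : |posetSSet R| ⟶ TopCat.of (stdSimplex ℝ R) :=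
  realizationDesc (C := posetSSet R) (X := TopCat.of (stdSimplex ℝ R))
    (fun n s ↦ ⟨stdSimplex.map (posetSSetEquiv R (op n) s), stdSimplex.continuous_map _⟩)
    (fun _ _ θ s t ↦
      (stdSimplex.map_comp_apply θ.toOrderHom (posetSSetEquiv R _ s) t).symm)

variable {R}

lemma nerveToStdSimplex_realizationMk {n : SimplexCategory} (s : (posetSSet R).obj (op n))
    (t : stdSimplex ℝ (Fin (n.len + 1))) :
    nerveToStdSimplex R (realizationMk s t) = stdSimplex.map (posetSSetEquiv R (op n) s) t :=
  realizationDesc_realizationMk _ _ s t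

lemma isChain_support_nerveToStdSimplex (x : |posetSSet R|) :
    IsChain (· ≤ ·) {r | nerveToStdSimplex R x r ≠ 0} := by
  obtain ⟨n, s, t, rfl⟩ := exists_realizationMk_eq x
  rw [nerveToStdSimplex_realizationMk]
  exact stdSimplex.isChain_support_map _ t

/-- The simplex of `S(R)` given by an order preserving map. -/
def simplexMk {k : ℕ} (f : Fin (k + 1) →o R) : (posetSSet R).obj (op ⦋k⦌) :=
  (posetSSetEquiv R (op ⦋k⦌)).symm f

omit [Fintype R] in
lemma realizationMk_comp {k n : ℕ} (θ : Fin (k + 1) →o Fin (n + 1)) (f : Fin (n + 1) →o R)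
    (t : stdSimplex ℝ (Fin (k + 1))) :
    realizationMk (simplexMk (f.comp θ)) t = realizationMk (simplexMk f) (stdSimplex.map θ t) :=
  realizationMk_map (n := ⦋k⦌) (m := ⦋n⦌) (SimplexCategory.Hom.mk θ) (simplexMk f) t

/-- Restrict `t` to the face spanned by its support. On that face `f` takes values in the chain `c`,
hence factors through it, and injectivity of `c` identifies the pushed-forward weights with `w`. -/
lemma realizationMk_eq_of_map_eq {n k : ℕ} {f : Fin (n + 1) →o R} {c : Fin (k + 1) ↪o R}
    {t : stdSimplex ℝ (Fin (n + 1))} {w : stdSimplex ℝ (Fin (k + 1))}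
    (h : stdSimplex.map f t = stdSimplex.map c w)
    (hc : {r | stdSimplex.map c w r ≠ 0} ⊆ Set.range c) :
    realizationMk (simplexMk f) t = realizationMk (simplexMk c.toOrderHom) w := by
  obtain ⟨l, θ, t', rfl, hθ⟩ := stdSimplex.exists_map_orderEmbedding_eq t
    fun a _ b _ _ ↦ le_total a b
  -- Weights are nonnegative, so nothing cancels under `f`.
  have hf : ∀ i, ∃ j, c j = f (θ i) := fun i ↦ hc <| by
    have hi : stdSimplex.map θ t' (θ i) ≠ 0 := hθ.subset ⟨i, rfl⟩
    have hi' := lt_of_le_of_ne ((stdSimplex.map θ t').2.1 (θ i)) hi.symm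
    rw [Set.mem_ofPred_eq, ← h]
    exact (hi'.trans_le (stdSimplex.le_map_apply f _ _)).ne'
  choose φ hφ using hf
  let φ' : Fin (l + 1) →o Fin (k + 1) :=
    ⟨φ, fun i j hij ↦ by
      rw [← c.le_iff_le, hφ, hφ]
      exact f.monotone (θ.monotone hij)⟩
  have hcomp : c.toOrderHom.comp φ' = f.comp θ.toOrderHom := OrderHom.ext _ _ (funext hφ)
  have hw : stdSimplex.map φ' t' = w := by
    apply stdSimplex.map_injective c.injective
    rw [← h]
    refine (stdSimplex.map_comp_apply φ c t').trans (Eq.trans ?_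
      (stdSimplex.map_comp_apply θ f t').symm)
    exact congrArg (fun g ↦ stdSimplex.map g t') (funext hφ)
  rw [← hw, ← realizationMk_comp, hcomp]
  exact (realizationMk_comp θ.toOrderHom f t').symm

/-- Every point of `|S(R)|` is carried by an injective simplex, determined by its image in
`stdSimplex ℝ R`. -/
lemma exists_realizationMk_orderEmbedding_eq (w : stdSimplex ℝ R)
    (hw : IsChain (· ≤ ·) {r | w r ≠ 0}) :
    ∃ (k : ℕ) (c : Fin (k + 1) ↪o R) (t : stdSimplex ℝ (Fin (k + 1))),
      ∀ x : |posetSSet R|, nerveToStdSimplex R x = w →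
        x = realizationMk (simplexMk c.toOrderHom) t := by
  obtain ⟨k, c, t, rfl, hc⟩ := stdSimplex.exists_map_orderEmbedding_eq w hw
  refine ⟨k, c, t, fun x hx ↦ ?_⟩
  obtain ⟨n, s, t', rfl⟩ := exists_realizationMk_eq x
  rw [nerveToStdSimplex_realizationMk] at hx
  exact realizationMk_eq_of_map_eq (n := n.len) hx hc.superset

lemma nerveToStdSimplex_injective : Function.Injective (nerveToStdSimplex R) := by
  intro x y h
  obtain ⟨k, c, t, H⟩ := exists_realizationMk_orderEmbedding_eq _
    (isChain_support_nerveToStdSimplex x)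
  rw [H x rfl, H y h.symm]

instance t2Space_realization_nerve (R : Type u) [PartialOrder R] [Finite R] :
    T2Space |posetSSet R| := by
  have := Fintype.ofFinite R
  exact T2Space.of_injective_continuous (Y := stdSimplex ℝ R) nerveToStdSimplex_injective
    (nerveToStdSimplex R).hom.continuous

instance compactSpace_realization_nerve (R : Type u) [PartialOrder R] [Finite R] :
    CompactSpace |posetSSet R| := by
  have := Fintype.ofFinite R
  have : ∀ k, Finite (Fin k →o R) := fun k ↦
    Finite.of_injective (fun f ↦ (f : Fin k → R)) DFunLike.coe_injective
  -- A chain in `R` has at most `Fintype.card R` elements, so finitely many simplices suffice to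
  -- cover.
  let T := Σ k : Fin (Fintype.card R), Σ _ : Fin (k + 1) →o R, stdSimplex ℝ (Fin (k + 1))
  let F : T → |posetSSet R| := fun x ↦ realizationMk (simplexMk x.2.1) x.2.2
  have hF : Continuous F := continuous_sigma fun k ↦ continuous_sigma fun f ↦
    continuous_realizationMk (simplexMk f)
  have hF' : Function.Surjective F := by
    intro x
    obtain ⟨k, c, t, H⟩ := exists_realizationMk_orderEmbedding_eq _
      (isChain_support_nerveToStdSimplex x)
    have hk : k < Fintype.card R := by
      simpa [Nat.succ_le_iff] using Fintype.card_le_of_injective c c.injective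
    exact ⟨⟨⟨k, hk⟩, c.toOrderHom, t⟩, (H x rfl).symm⟩
  exact hF'.compactSpace hF

end Nerve

/-! ### The canonical map for products -/

section Prod

variable (P Q : Type u) [PartialOrder P] [PartialOrder Q]

/-- The product of nerves is the nerve of the product. -/
def nerveProdIso : posetSSet (P × Q) ≅ posetSSet P ⊗ posetSSet Q :=
  NatIso.ofComponents fun n ↦ Equiv.toIso
    { toFun s := ⟨(posetSSetEquiv P n).symm (OrderHom.fst.comp (posetSSetEquiv (P × Q) n s)),
        (posetSSetEquiv Q n).symm (OrderHom.snd.comp (posetSSetEquiv (P × Q) n s))⟩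
      invFun x := (posetSSetEquiv (P × Q) n).symm
        ((posetSSetEquiv P n x.1).prod (posetSSetEquiv Q n x.2))
      left_inv _ := rfl
      right_inv _ := rfl }

variable {P Q}

lemma nerveToStdSimplex_fst [Fintype P] [Fintype Q] (x : |posetSSet (P × Q)|) :
    nerveToStdSimplex P (toTop.map ((nerveProdIso P Q).hom ≫ fst _ _) x) =
      stdSimplex.map Prod.fst (nerveToStdSimplex (P × Q) x) := by
  obtain ⟨n, s, t, rfl⟩ := exists_realizationMk_eq x
  rw [toTop_map_realizationMk, nerveToStdSimplex_realizationMk, nerveToStdSimplex_realizationMk,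
    stdSimplex.map_comp_apply]
  rfl

lemma nerveToStdSimplex_snd [Fintype P] [Fintype Q] (x : |posetSSet (P × Q)|) :
    nerveToStdSimplex Q (toTop.map ((nerveProdIso P Q).hom ≫ snd _ _) x) =
      stdSimplex.map Prod.snd (nerveToStdSimplex (P × Q) x) := by
  obtain ⟨n, s, t, rfl⟩ := exists_realizationMk_eq x
  rw [toTop_map_realizationMk, nerveToStdSimplex_realizationMk, nerveToStdSimplex_realizationMk,
    stdSimplex.map_comp_apply]
  rfl

lemma realizationProdMap_nerveProdIso (x : |posetSSet (P × Q)|) :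
    realizationProdMap (posetSSet P) (posetSSet Q) (toTop.map (nerveProdIso P Q).hom x) =
      (toTop.map ((nerveProdIso P Q).hom ≫ fst _ _) x,
        toTop.map ((nerveProdIso P Q).hom ≫ snd _ _) x) := by
  rw [Functor.map_comp, Functor.map_comp]
  rfl

lemma exists_nerveProdIso_hom_eq (x : |posetSSet P ⊗ posetSSet Q|) :
    ∃ y, toTop.map (nerveProdIso P Q).hom y = x :=
  ⟨toTop.map (nerveProdIso P Q).inv x, by
    rw [← ConcreteCategory.comp_apply, ← Functor.map_comp, Iso.inv_hom_id, CategoryTheory.Functor.map_id]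
    rfl⟩

lemma realizationProdMap_injective [Finite P] [Finite Q] :
    Function.Injective (realizationProdMap (posetSSet P) (posetSSet Q)) := by
  have := Fintype.ofFinite P
  have := Fintype.ofFinite Q
  intro x y h
  obtain ⟨x, rfl⟩ := exists_nerveProdIso_hom_eq x
  obtain ⟨y, rfl⟩ := exists_nerveProdIso_hom_eq y
  rw [realizationProdMap_nerveProdIso, realizationProdMap_nerveProdIso, Prod.mk.injEq] at h
  congr 1
  apply nerveToStdSimplex_injective
  apply stdSimplex.eq_of_map_fst_eq_of_map_snd_eq
    (isChain_support_nerveToStdSimplex x) (isChain_support_nerveToStdSimplex y)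
  · rw [← nerveToStdSimplex_fst, ← nerveToStdSimplex_fst, h.1]
  · rw [← nerveToStdSimplex_snd, ← nerveToStdSimplex_snd, h.2]

lemma realizationProdMap_surjective :
    Function.Surjective (realizationProdMap (posetSSet P) (posetSSet Q)) := by
  rintro ⟨x, y⟩
  obtain ⟨n, s, u, rfl⟩ := exists_realizationMk_eq x
  obtain ⟨m, s', v, rfl⟩ := exists_realizationMk_eq y
  -- Each point lies in a single simplex, so the coupling takes place on a product of two finite
  -- linear orders; its chain support yields the required simplex of `P × Q`.
  obtain ⟨w, hw, rfl, rfl⟩ := stdSimplex.exists_isChain_coupling u v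
  obtain ⟨k, c, t, rfl, -⟩ := stdSimplex.exists_map_orderEmbedding_eq w hw
  let f : Fin (n.len + 1) →o P := posetSSetEquiv P _ s
  let g : Fin (m.len + 1) →o Q := posetSSetEquiv Q _ s'
  refine ⟨toTop.map (nerveProdIso P Q).hom
    (realizationMk (simplexMk ((f.prodMap g).comp c.toOrderHom)) t), ?_⟩
  rw [realizationProdMap_nerveProdIso, toTop_map_realizationMk, toTop_map_realizationMk,
    stdSimplex.map_comp_apply, stdSimplex.map_comp_apply]
  exact Prod.ext (realizationMk_comp (OrderHom.fst.comp c.toOrderHom) f t)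
    (realizationMk_comp (OrderHom.snd.comp c.toOrderHom) g t)

lemma continuous_realizationProdMap (C D : SSet.{u}) : Continuous (realizationProdMap C D) :=
  (toTop.map (fst C D)).hom.continuous.prodMk (toTop.map (snd C D)).hom.continuous

/-- Geometric realization commutes with products of nerves of finite posets. -/
theorem isHomeomorph_realizationProdMap_nerve (P Q : Type u) [PartialOrder P] [Finite P]
    [PartialOrder Q] [Finite Q] :
    IsHomeomorph (realizationProdMap (posetSSet P) (posetSSet Q)) := by
  have : CompactSpace |posetSSet P ⊗ posetSSet Q| :=
    (TopCat.homeoOfIso (toTop.mapIso (nerveProdIso P Q))).compactSpace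
  exact isHomeomorph_iff_continuous_bijective.2 ⟨continuous_realizationProdMap _ _,
    realizationProdMap_injective, realizationProdMap_surjective⟩

end Prod

lemma isHomeomorph_realizationProdMap_of_iso {C C' D D' : SSet.{u}} (α : C ≅ C') (β : D ≅ D')
    (h : IsHomeomorph (realizationProdMap C' D')) : IsHomeomorph (realizationProdMap C D) := by
  have hcomp : realizationProdMap C D =
      Prod.map (TopCat.homeoOfIso (toTop.mapIso α)).symm
        (TopCat.homeoOfIso (toTop.mapIso β)).symm ∘ realizationProdMap C' D' ∘
      TopCat.homeoOfIso (toTop.mapIso (α ⊗ᵢ β)) := by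
    have h₁ : fst C D = (α.hom ⊗ₘ β.hom) ≫ fst C' D' ≫ α.inv := by simp
    have h₂ : snd C D = (α.hom ⊗ₘ β.hom) ≫ snd C' D' ≫ β.inv := by simp
    funext x
    rw [realizationProdMap, h₁, h₂]
    simp only [Functor.map_comp]
    rfl
  rw [hcomp]
  exact ((Homeomorph.isHomeomorph _).prodMap (Homeomorph.isHomeomorph _)).comp
    (h.comp (Homeomorph.isHomeomorph _))

theorem isHomeomorph_realizationProdMap_stdSimplex (n m : ℕ) :
    IsHomeomorph (realizationProdMap (Δ[n] : SSet.{u}) Δ[m]) :=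
  isHomeomorph_realizationProdMap_of_iso (SSet.stdSimplex.isoNerve n) (SSet.stdSimplex.isoNerve m)
    (isHomeomorph_realizationProdMap_nerve _ _)

end GeometricRealization

theorem mainTheorem1 :
    (∀ (P Q : Type u) [PartialOrder P] [Finite P] [PartialOrder Q] [Finite Q],
      ∃ e : SSet.toTop.obj (posetSSet P ⊗ posetSSet Q) ≃ₜ
          SSet.toTop.obj (posetSSet P) × SSet.toTop.obj (posetSSet Q),
        ∀ x, e x = realizationProdMap (posetSSet P) (posetSSet Q) x) ∧
    (∀ n m : ℕ,
      (∃ e : SSet.toTop.obj ((Δ[n] : SSet.{u}) ⊗ Δ[m]) ≃ₜ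
          SSet.toTop.obj (Δ[n] : SSet.{u}) × SSet.toTop.obj (Δ[m] : SSet.{u}),
        ∀ x, e x = realizationProdMap Δ[n] Δ[m] x) ∧
      (∃ e : SSet.toTop.obj ((Δ[n] : SSet.{u}) ⊗ Δ[m]) ≃ₜ
          stdSimplex ℝ (Fin (n + 1)) × stdSimplex ℝ (Fin (m + 1)),
        ∀ x, e x =
          (SimplexCategory.toTopHomeo ⦋n⦌ (realizationProdMap Δ[n] Δ[m] x).1,
            SimplexCategory.toTopHomeo ⦋m⦌ (realizationProdMap Δ[n] Δ[m] x).2))) := by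
  refine ⟨fun P Q _ _ _ _ ↦
    ⟨(GeometricRealization.isHomeomorph_realizationProdMap_nerve P Q).homeomorph, fun _ ↦ rfl⟩,
    fun n m ↦ ?_⟩
  have h := GeometricRealization.isHomeomorph_realizationProdMap_stdSimplex.{u} n m
  exact ⟨⟨h.homeomorph, fun _ ↦ rfl⟩,
    ⟨h.homeomorph.trans ((SimplexCategory.toTopHomeo ⦋n⦌).prodCongr
      (SimplexCategory.toTopHomeo ⦋m⦌)), fun _ ↦ rfl⟩⟩
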